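/- \textbf{Setting.} There are $n\ge 2(f+s)+1$ nodes, of which at most $f$ are malicious; the others are honest. At every time at most $s$ nodes are sluggish (the set may change with time); a node is \emph{prompt} at time $t$ if it is honest and not sluggish at $t$. Channels are authenticated, signatures are unforgeable and hashing is collision free. If an honest node sent a message by time $t_1$ and is prompt at $t_1$, the receiver has the message by every time $t_2\ge t_1+\Delta$ at which the receiver is prompt ($\Delta>0$); all other delays are arbitrary. Put $q=f+s+1$. Blocks are cut into $k$ chunks of equal length and encoded into $n$ chunks by an $(n,k)$ MDS code, $1\le k\le n$; $H(B)$ is the Merkle root of the coded chunks of $B$. The identifier block of a block $B_h$ at height $h\ge1$ is $I_h=(H(B_h),H(I_{h-1}))$, with $I_0=\perp$. A block \emph{extends} itself and all its predecessors; two identifier blocks \emph{equivocate} if neither extends the other. A certificate $C_v(I)$ consists of votes for $I$ in view $v$ from $q$ distinct nodes (for $\perp$ in the initial view $0$ no votes are needed). It has rank $(v,\text{height of }I)$, ordered lexicographically. \textbf{Protocol.} Nodes are in views $0,1,2,\dots$; the leader of view $v$ is node $v \bmod n$ (nodes numbered from $0$). In view $v$ the leader, once it has $C_v(I_{h-1})$,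 sends every node $r$ a signed proposal with the $r$-th chunk of $B_h$, $I_h$ and $C_v(I_{h-1})$. Each node forwards to all nodes the first proposal of each height that it receives and one tailored to itself. A node with $k$ different chunks for $I_h$ that decode to a block with Merkle root as in $I_h$ may broadcast a vote for $I_h$ in view $v$. A node that has received proposals of height $h+1$ carrying $C_v(I_h)$ from $q$ distinct nodes starts a timer of $2\Delta$; if it is still in view $v$ when the timer expires it broadcasts a commit message for $I_h$ in view $v$. A node \emph{directly commits} $I_h$ (or $B_h$) in view $v$ when it has such commit messages from $q$ distinct nodes; it \emph{commits} every identifier block that a directly committed one extends. A node leaves view $v$ as soon as it has evidence against the leader: two proposals or new-view messages of view $v$ for equivocating blocks, $k$ segments whose decoding contradicts their common identifier block, or blame messages from $q$ distinct nodes. It then sends the evidence to all nodes in a quit-view message, locks on a highest-ranked certificate it has, sends it to the next leader and enters view $v+1$. After $2\Delta$ in view $v+1$ the new leader broadcasts a new-view message with its highest certificate $C_{v''}(I)$, $v''\le v$. A node whose lock has no higher rank may forward this message to all nodes and vote for $I$ in view $v+1$. In the Follow phase, chunks of committed blocks are distributed with Merkle proofs, and a node that committed $I_h$ and has $k$ different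 chunks verified against $I_h$ decodes them and commits the resulting block. \textbf{Claim.} In every execution, if an honest node has directly committed $B_h$ (that is, $I_h$) in view $v$ by time $t$, then: (i) Some block $B_h$ has identifier block $I_h$ and, for every time $\tau$, some node that is prompt at $\tau$ decoded $B_h$ by time $t$; it did so while in view $v$ or, in the case that a new-view message of view $v$ for $I_h$ itself reached some honest node by time $t$, while in a view $w\le v$. (ii) No certificate of view $v$ for an identifier block that equivocates with $I_h$ can ever be formed. (iii) There are at least $f+s+1$ (in particular $f+1$) honest nodes each of which holds, at some time while in view $v$, a certificate of rank at least $(v,h)$, and which, if it enters view $v+1$, locks before entering it on a certificate of rank at least $(v,h)$. Consequently, safety holds under mobile sluggish faults. If an honest node directly commits $I_h$ in view $v$, every certificate of rank at least $(v,h)$ that can be formed is for an identifier block that extends $I_h$. Identifier blocks of the same height committed by honest nodes are equal. For each $I_h$ with $h\ge 1$ committed by an honest node by time $t$, there is a block $B_h$ with identifier block $I_h$ such that, for every $\tau$, some node prompt at $\tau$ decoded $B_h$ by time $t$. Finally, blocks committed by honest nodes in the Follow phase at the same height are equal. -/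

import Mathlib

namespace Hamster

/-! ### Coded blocks and Merkle trees -/

/-- A chunk: a finite sequence of symbols. -/
abbrev Chunk (F : Type*) := Σ ℓ : ℕ, (Fin ℓ → F)

/-- A data word: `k` chunks of one common length. -/
abbrev Word (k : ℕ) (F : Type*) := Σ ℓ : ℕ, (Fin k → Fin ℓ → F)

/-- A block `B_h = (b_h, H(B_{h-1}))`; the predecessor is `none` for the first block. -/
structure Block (D P : Type*) where
  payload : P
  prev : Option D

/-- What is hashed: an indexed chunk `i|y_i`, or the concatenation of two digests. -/
inductive HashInput (F D : Type*) where
  | leaf (i : ℕ) (y : Chunk F)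
  | node (l r : D)

/-- The value of the node over the `2 ^ d` leaves `lo, …, lo + 2 ^ d - 1`. -/
def merkle {F D : Type*} (hash : HashInput F D → D) (leaf : ℕ → D) : ℕ → ℕ → D
  | 0, lo => leaf lo
  | d + 1, lo => hash (.node (merkle hash leaf d lo) (merkle hash leaf d (lo + 2 ^ d)))

/-- Recompute the root from the value of a leaf and its Merkle path. The path is listed from the
root downwards; the flag says whether the node on the path is the left child. -/
def climb {F D : Type*} (hash : HashInput F D → D) (x : D) : List (Bool × D) → D
  | [] => x
  | (true, d) :: p => hash (.node (climb hash x p) d)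
  | (false, d) :: p => hash (.node d (climb hash x p))

/-- The `i`-th output chunk of the linear code with generator matrix `G`. -/
def encode {n k : ℕ} {F : Type*} [Field F] (G : Matrix (Fin n) (Fin k) F) (w : Word k F)
    (i : Fin n) : Chunk F :=
  ⟨w.1, fun c => ∑ j, G i j * w.2 j c⟩

/-- Maximum distance separable: any `k` output chunks determine the word. -/
def IsMDS {n k : ℕ} {F : Type*} [Field F] (G : Matrix (Fin n) (Fin k) F) : Prop :=
  ∀ e : Fin k ↪ Fin n, (G.submatrix e id).det ≠ 0

/-! ### Identifier blocks -/

/-- Identifier blocks `I_h = (H(B_h), H(I_{h-1}))`. Hashing is collision free, so the pointer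
`H(I_{h-1})` is represented by `I_{h-1}` itself. `genesis` is the `⊥` before the first block. -/
inductive IdBlock (D : Type*) where
  | genesis
  | next (root : D) (prev : IdBlock D)

namespace IdBlock

variable {D : Type*}

def height : IdBlock D → ℕ
  | genesis => 0
  | next _ J => J.height + 1

/-- `A.Extends B`: `B` is `A` or one of its predecessors. -/
inductive Extends : IdBlock D → IdBlock D → Prop
  | refl (A : IdBlock D) : Extends A A
  | step (r : D) {A B : IdBlock D} : Extends A B → Extends (next r A) B

/-- Two identifier blocks equivocate if neither extends the other. -/
def Equivocates (A B : IdBlock D) : Prop := ¬ A.Extends B ∧ ¬ B.Extends A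

end IdBlock

/-! ### Messages -/

/-- The leader of view `v`: nodes are numbered `0, …, n - 1`. -/
def leader (n : ℕ) [NeZero n] (v : ℕ) : Fin n := Fin.ofNat n v

/-- A quorum certificate `C_view(block)`: votes for `block` in `view`, signed by `voters`. -/
structure Cert (n : ℕ) (D : Type*) where
  view : ℕ
  block : IdBlock D
  voters : Finset (Fin n)

namespace Cert

variable {n : ℕ} {D : Type*}

/-- Ranks are compared by view first, then by height. -/
def rank (C : Cert n D) : ℕ ×ₗ ℕ := toLex (C.view, C.block.height)

/-- The initial view `0` starts from a certificate for `⊥` that needs no votes. -/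
def IsGenesis (C : Cert n D) : Prop := C.view = 0 ∧ C.block = .genesis

end Cert

/-- A segment `Y_h^idx = (idx, y_h^idx, I_h)`. -/
structure Segment (n : ℕ) (F D : Type*) where
  idx : Fin n
  chunk : Chunk F
  ident : IdBlock D

/-- Messages signed by the leader of their view. -/
inductive LeaderMsg (n : ℕ) (F D : Type*) where
  | proposal (v : ℕ) (Y : Segment n F D) (C : Cert n D)
  | newView (v : ℕ) (C : Cert n D)

namespace LeaderMsg

variable {n : ℕ} {F D : Type*}

def view : LeaderMsg n F D → ℕ
  | proposal v _ _ => v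
  | newView v _ => v

/-- The identifier block that the leader puts forward. -/
def block : LeaderMsg n F D → IdBlock D
  | proposal _ Y _ => Y.ident
  | newView _ C => C.block

def cert : LeaderMsg n F D → Cert n D
  | proposal _ _ C => C
  | newView _ C => C

end LeaderMsg

/-- Evidence against the leader of a view. -/
inductive Evidence (n k : ℕ) (F D : Type*) where
  | equivocation (m₁ m₂ : LeaderMsg n F D)
  | error (Y : Fin k → Segment n F D) (C : Fin k → Cert n D)
  | silence (blamers : Finset (Fin n))

/-- Messages; `r` is the node that signed the message. Leader messages carry the signature of the
leader of their view, follow messages are not signed. -/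
inductive Msg (n k : ℕ) (F D : Type*) where
  | lead (m : LeaderMsg n F D)
  | vote (r : Fin n) (I : IdBlock D) (v : ℕ)
  | commit (r : Fin n) (I : IdBlock D) (v : ℕ)
  | blame (r : Fin n) (v : ℕ)
  | quit (r : Fin n) (ε : Evidence n k F D) (v : ℕ)
  | status (r : Fin n) (C : Cert n D) (v : ℕ)
  | follow (Y : Segment n F D) (path : List (Bool × D))

/-- The signed votes packed in a certificate. -/
def Cert.votes {n : ℕ} {D : Type*} (k : ℕ) (F : Type*) (C : Cert n D) : Set (Msg n k F D) :=
  {m | ∃ r ∈ C.voters, m = .vote r C.block C.view}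

/-- The signed messages contained in a leader message. -/
def LeaderMsg.parts {n : ℕ} {F D : Type*} (k : ℕ) (m : LeaderMsg n F D) : Set (Msg n k F D) :=
  insert (.lead m) (m.cert.votes k F)

/-- The signed messages contained in evidence against the leader of view `v`. -/
def Evidence.parts {n k : ℕ} {F D : Type*} (v : ℕ) : Evidence n k F D → Set (Msg n k F D)
  | equivocation m₁ m₂ => m₁.parts k ∪ m₂.parts k
  | error Y C => ⋃ i, (LeaderMsg.proposal v (Y i) (C i)).parts k
  | silence b => {m | ∃ r ∈ b, m = .blame r v}

namespace Msg

variable {n k : ℕ} {F D : Type*}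

/-- The messages contained in a message, itself included. -/
def parts : Msg n k F D → Set (Msg n k F D)
  | lead m => m.parts k
  | quit r ε v => insert (quit r ε v) (ε.parts v)
  | status r C v => insert (status r C v) (C.votes k F)
  | m => {m}

/-- The node whose signature a message carries. -/
def signer [NeZero n] : Msg n k F D → Option (Fin n)
  | lead m => some (leader n m.view)
  | vote r _ _ => some r
  | commit r _ _ => some r
  | blame r _ => some r
  | quit r _ _ => some r
  | status r _ _ => some r
  | follow _ _ => none

end Msg

/-! ### Parameters of the protocol -/

/-- Parameters: at most `f` malicious nodes, at most `s` sluggish nodes at a time, the synchronous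
bound `Δ`, the generator matrix of an `(n, k)` code, a hash function, and the division of a block
into `k` chunks of equal length. -/
structure Protocol (n k : ℕ) (F D P : Type*) where
  f : ℕ
  s : ℕ
  Δ : ℝ
  G : Matrix (Fin n) (Fin k) F
  hash : HashInput F D → D
  divide : Block D P → Word k F

namespace Protocol

variable {n k : ℕ} {F D P : Type*} [Field F] (S : Protocol n k F D P)

/-- The number of distinct nodes required in every threshold of the protocol: one more than the
number of nodes that can be malicious or sluggish at the same time. -/
def quorum : ℕ := S.f + S.s + 1

/-- The `i`-th coded chunk of a block. -/
def chunkOf (B : Block D P) (i : Fin n) : Chunk F := encode S.G (S.divide B) i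

/-- `H(B)`: the root of the Merkle tree with leaves `hash(i|y_i)` over the coded chunks `y_i` of
`B`, padded with empty chunks to a full binary tree. -/
def blockRoot (B : Block D P) : D :=
  merkle S.hash
    (fun j => S.hash (.leaf j (if h : j < n then S.chunkOf B ⟨j, h⟩ else ⟨0, Fin.elim0⟩)))
    (Nat.clog 2 n) 0

/-- `I` is the identifier block of the block `B`. -/
def Identifies (I : IdBlock D) (B : Block D P) : Prop := ∃ J, I = .next (S.blockRoot B) J

/-- The Merkle proof `path` shows that the segment belongs to its identifier block. -/
def Verifies (Y : Segment n F D) (path : List (Bool × D)) : Prop :=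
  ∃ J, Y.ident = .next (climb S.hash (S.hash (.leaf Y.idx Y.chunk)) path) J

/-- The certificate has enough voters. -/
def CertWF (C : Cert n D) : Prop := C.IsGenesis ∨ S.quorum ≤ C.voters.card

/-- Legal format of leader messages: a proposal of view `v` carries a certificate of view `v` for
the predecessor, a new-view message a certificate from an earlier view. -/
def LeaderWF : LeaderMsg n F D → Prop
  | .proposal v Y C => C.view = v ∧ S.CertWF C ∧ ∃ r, Y.ident = .next r C.block
  | .newView v C => C.view < v ∧ S.CertWF C

/-- Valid evidence against the leader of view `v`: two leader messages that do not extend one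
another, `k` segments for one identifier block whose decoding does not match it, or a quorum of
blames. -/
def EvidenceValid (v : ℕ) : Evidence n k F D → Prop
  | .equivocation m₁ m₂ => m₁.view = v ∧ m₂.view = v ∧ S.LeaderWF m₁ ∧ S.LeaderWF m₂ ∧
      m₁.block.Equivocates m₂.block
  | .error Y C => (∀ i, S.LeaderWF (.proposal v (Y i) (C i))) ∧
      Function.Injective (fun i => (Y i).idx) ∧
      ∃ I, (∀ i, (Y i).ident = I) ∧
        ∀ B, (∀ i, (Y i).chunk = S.chunkOf B (Y i).idx) → ¬ S.Identifies I B
  | .silence b => S.quorum ≤ b.card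

/-- Legal format of messages; all others are ignored. -/
def MsgWF : Msg n k F D → Prop
  | .lead m => S.LeaderWF m
  | .quit _ ε v => S.EvidenceValid v ε
  | .status _ C _ => S.CertWF C
  | _ => True

end Protocol

/-! ### Executions -/

/-- A record of what happens. `sent p q m t`: at time `t`, `p` sends `m` to `q`.
`recv p q m t`: at time `t`, `p` receives `m` from `q` over their authenticated channel.
`lock p v`: the certificate on which `p` locks when it enters view `v`. -/
structure Execution (n k : ℕ) (F D : Type*) where
  honest : Finset (Fin n)
  sluggish : ℝ → Finset (Fin n)
  sent : Fin n → Fin n → Msg n k F D → ℝ → Prop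
  recv : Fin n → Fin n → Msg n k F D → ℝ → Prop
  lock : Fin n → ℕ → Cert n D

namespace Execution

variable {n k : ℕ} {F D P : Type*} [Field F] (E : Execution n k F D) (S : Protocol n k F D P)

/-- Prompt nodes at time `t`: honest and not sluggish. -/
def Prompt (p : Fin n) (t : ℝ) : Prop := p ∈ E.honest ∧ p ∉ E.sluggish t

/-- By time `t`, `p` got the legal message `m` from `q` (its own messages count as got from
itself). -/
def GotFrom (p q : Fin n) (m : Msg n k F D) (t : ℝ) : Prop :=
  S.MsgWF m ∧ ∃ t' ≤ t, E.recv p q m t' ∨ (q = p ∧ ∃ c, E.sent p c m t')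

def Knows (p : Fin n) (m : Msg n k F D) (t : ℝ) : Prop := ∃ q, E.GotFrom S p q m t

/-- `p` has `m`, possibly as a part of another message. -/
def Holds (p : Fin n) (m : Msg n k F D) (t : ℝ) : Prop := ∃ M, E.Knows S p M t ∧ m ∈ M.parts

/-- `p` has the certificate `C`, or the votes that form it. -/
def HoldsCert (p : Fin n) (C : Cert n D) (t : ℝ) : Prop :=
  S.CertWF C ∧ ∀ m ∈ C.votes k F, E.Holds S p m t

def HasEvidence (p : Fin n) (v : ℕ) (t : ℝ) : Prop :=
  ∃ ε, S.EvidenceValid v ε ∧ ∀ m ∈ ε.parts v, E.Holds S p m t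

/-- A node leaves a view as soon as it has evidence against its leader. So by time `t` it has
entered view `v` iff it has evidence against all earlier views. -/
def Entered (p : Fin n) (v : ℕ) (t : ℝ) : Prop := ∀ w < v, E.HasEvidence S p w t

def InView (p : Fin n) (v : ℕ) (t : ℝ) : Prop := E.Entered S p v t ∧ ¬ E.HasEvidence S p v t

/-- `p` enters view `v` at time `e`. -/
def EntersAt (p : Fin n) (v : ℕ) (e : ℝ) : Prop := IsLeast {t | E.Entered S p v t} e

/-- `C` is a certificate of highest rank among those that `p` has. -/
def HighestCert (p : Fin n) (C : Cert n D) (t : ℝ) : Prop :=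
  E.HoldsCert S p C t ∧ ∀ C', E.HoldsCert S p C' t → C'.rank ≤ C.rank

/-- By time `t`, `p` has decoded `B` from `k` segments for `I` proposed in view `v`, and the result
matches `I`. -/
def Decoded (p : Fin n) (v : ℕ) (I : IdBlock D) (B : Block D P) (t : ℝ) : Prop :=
  S.Identifies I B ∧ ∃ (Y : Fin k → Segment n F D) (C : Fin k → Cert n D),
    Function.Injective (fun i => (Y i).idx) ∧
    ∀ i, (Y i).ident = I ∧ (Y i).chunk = S.chunkOf B (Y i).idx ∧
      E.Knows S p (.lead (.proposal v (Y i) (C i))) t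

/-- By time `t`, `p` got new proposals carrying `C_v(I)` from a quorum of different nodes. -/
def GotNewProposals (p : Fin n) (I : IdBlock D) (v : ℕ) (t : ℝ) : Prop :=
  ∃ Q : Finset (Fin n), S.quorum ≤ Q.card ∧ ∀ q ∈ Q, ∃ Y C, C.block = I ∧
    E.GotFrom S p q (.lead (.proposal v Y C)) t

/-- By time `t`, `p` has directly committed `I` in view `v`: it has commit messages for `I` in view
`v` from a quorum of different nodes. -/
def DirectlyCommits (p : Fin n) (I : IdBlock D) (v : ℕ) (t : ℝ) : Prop :=
  ∃ Q : Finset (Fin n), S.quorum ≤ Q.card ∧ ∀ r ∈ Q, E.Knows S p (.commit r I v) t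

/-- By time `t`, `p` has committed `I`, directly or through a block that extends it. -/
def Commits (p : Fin n) (I : IdBlock D) (t : ℝ) : Prop :=
  ∃ J v, E.DirectlyCommits S p J v t ∧ J.Extends I

/-- The Follow phase: by time `t`, `p` has committed `I`, and `B` is the result of decoding `k`
different verified follow messages for `I`; `p` then commits the block `B`. -/
def FollowCommits (p : Fin n) (I : IdBlock D) (B : Block D P) (t : ℝ) : Prop :=
  E.Commits S p I t ∧ ∃ (Y : Fin k → Segment n F D) (π : Fin k → List (Bool × D)),
    Function.Injective (fun i => (Y i).idx) ∧
    ∀ i, (Y i).ident = I ∧ (Y i).chunk = S.chunkOf B (Y i).idx ∧ S.Verifies (Y i) (π i) ∧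
      E.Knows S p (.follow (Y i) (π i)) t

/-- The certificate can be generated at some time: it has enough voters, and the honest ones have
sent their votes. -/
def Formable (C : Cert n D) : Prop :=
  C.IsGenesis ∨ (S.quorum ≤ C.voters.card ∧
    ∀ r ∈ C.voters, r ∈ E.honest → ∃ c t, E.sent r c (.vote r C.block C.view) t)

/-- The mobile sluggish model. Malicious nodes may send anything except forged signatures. A
message sent by an honest node that is prompt at `t₁`, after sending it, has reached its receiver
whenever that one is prompt at a time `t₂ ≥ t₁ + Δ`; all other delays are arbitrary. -/
structure Network [NeZero n] : Prop where
  malicious_card : E.honestᶜ.card ≤ S.f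
  sluggish_card : ∀ t, (E.sluggish t).card ≤ S.s
  recv_sent : ∀ p q m t, E.recv p q m t → ∃ t' ≤ t, E.sent q p m t'
  delivery : ∀ p q m t₀ t₁ t₂, E.sent q p m t₀ → t₀ ≤ t₁ → E.Prompt q t₁ → E.Prompt p t₂ →
    t₁ + S.Δ ≤ t₂ → ∃ t' ≤ t₂, E.recv p q m t'
  unforgeable : ∀ p q M t, E.sent p q M t → ∀ m ∈ M.parts, ∀ r, m.signer = some r →
    r ∈ E.honest → ∃ c, ∃ t' ≤ t, E.sent r c m t'

/-- What the protocol asks of a node `p`. The rules say when `p` may send a message, and they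
require the forwarding, quitting and locking steps. They do not force `p` to propose, vote, blame
or commit, so they allow all runs of the protocol. Local steps take no time, and messages that
arrive at time `t` are processed before other steps at time `t`. -/
structure Follows [NeZero n] (p : Fin n) : Prop where
  legal : ∀ q m t, E.sent p q m t → S.MsgWF m
  /-- A proposal is sent in its view, by the leader (one block per height, correctly coded, after
  obtaining the certificate for its predecessor) or as a forwarded message. -/
  propose : ∀ q v Y C t, E.sent p q (.lead (.proposal v Y C)) t → E.InView S p v t ∧
    ((p = leader n v ∧ E.HoldsCert S p C t ∧
        (∃ B, S.Identifies Y.ident B ∧ Y.chunk = S.chunkOf B Y.idx) ∧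
        ∀ q' Y' C' t', E.sent p q' (.lead (.proposal v Y' C')) t' →
          Y'.ident.height = Y.ident.height → Y'.ident = Y.ident) ∨
      ∃ q', ∃ t' ≤ t, E.recv p q' (.lead (.proposal v Y C)) t')
  /-- The first proposal of each height is forwarded to all nodes. -/
  repropose_first : ∀ v Y C t, E.InView S p v t → E.Knows S p (.lead (.proposal v Y C)) t →
    ∃ Y₀ C₀, Y₀.ident.height = Y.ident.height ∧
      (∀ Y₁ C₁ t₁, Y₁.ident.height = Y.ident.height →
        E.Knows S p (.lead (.proposal v Y₁ C₁)) t₁ → E.Knows S p (.lead (.proposal v Y₀ C₀)) t₁) ∧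
      ∃ t' ≤ t, ∀ q, E.sent p q (.lead (.proposal v Y₀ C₀)) t'
  /-- A proposal tailored for `p` is forwarded to all nodes, one for each height. -/
  repropose_own : ∀ v Y C t, E.InView S p v t → E.Knows S p (.lead (.proposal v Y C)) t →
    Y.idx = p → ∃ Y₀ C₀, Y₀.ident.height = Y.ident.height ∧ Y₀.idx = p ∧
      ∃ t' ≤ t, ∀ q, E.sent p q (.lead (.proposal v Y₀ C₀)) t'
  /-- A vote is broadcast in its view, for a decoded block, or for the block of a forwarded new-view
  message whose certificate has at least the rank of the lock. -/
  vote : ∀ q I v t, E.sent p q (.vote p I v) t → E.InView S p v t ∧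
    (∀ q', E.sent p q' (.vote p I v) t) ∧
    ((∃ B, E.Decoded S p v I B t) ∨
      ∃ C, C.block = I ∧ E.Knows S p (.lead (.newView v C)) t ∧ (E.lock p v).rank ≤ C.rank ∧
        ∃ t' ≤ t, ∀ q', E.sent p q' (.lead (.newView v C)) t')
  /-- A commit message is broadcast when the timer, set to `2Δ` at a time `T` in the view at which
  `p` has the new proposals, has expired and `p` is still in the view. -/
  precommit : ∀ q I v t, E.sent p q (.commit p I v) t → I ≠ .genesis ∧ E.InView S p v t ∧
    (∀ q', E.sent p q' (.commit p I v) t) ∧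
    ∃ T, T + 2 * S.Δ ≤ t ∧ E.InView S p v T ∧ E.GotNewProposals S p I v T
  /-- A blame is broadcast after fewer than `j` votes in `(3j + 4)Δ` time in the view. -/
  blame : ∀ q v t, E.sent p q (.blame p v) t → E.InView S p v t ∧
    (∀ q', E.sent p q' (.blame p v) t) ∧
    ∃ (e : ℝ) (j : ℕ), E.Entered S p v e ∧ e + (3 * j + 4) * S.Δ ≤ t ∧
      {I | ∃ q', ∃ t' ≤ t, E.sent p q' (.vote p I v) t'}.encard < j
  quit : ∀ q ε v t, E.sent p q (.quit p ε v) t →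
    E.Entered S p v t ∧ ∀ m ∈ ε.parts v, E.Holds S p m t
  status : ∀ q C v t, E.sent p q (.status p C v) t →
    q = leader n v ∧ C = E.lock p v ∧ E.Entered S p v t
  /-- On leaving view `v`, node `p` sends a quit-view message, its own or a forwarded one, to all
  nodes, locks on a highest certificate, sends it to the new leader and enters view `v + 1`. -/
  leave : ∀ v t, E.Entered S p (v + 1) t → ∃ e ≤ t, E.EntersAt S p (v + 1) e ∧
    (∃ r ε, ∀ q, E.sent p q (.quit r ε v) e) ∧
    E.HighestCert S p (E.lock p (v + 1)) e ∧
    E.sent p (leader n (v + 1)) (.status p (E.lock p (v + 1)) (v + 1)) e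
  /-- A new-view message is sent in its view, by the leader with its highest certificate and at
  least `2Δ` after entering, or as a forwarded message. -/
  newView : ∀ q v C t, E.sent p q (.lead (.newView v C)) t → E.InView S p v t ∧
    ((p = leader n v ∧ (∃ e, E.Entered S p v e ∧ e + 2 * S.Δ ≤ t) ∧ E.HighestCert S p C t ∧
        ∀ q' C' t', E.sent p q' (.lead (.newView v C')) t' → C' = C) ∨
      ∃ q', ∃ t' ≤ t, E.recv p q' (.lead (.newView v C)) t')
  /-- A follow message is sent by a node that has the block of a committed identifier block to the
  node of its segment, or forwarded by the latter after verifying it. -/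
  follow : ∀ q Y π t, E.sent p q (.follow Y π) t → E.Commits S p Y.ident t ∧ S.Verifies Y π ∧
    ((q = Y.idx ∧ ∃ B, Y.chunk = S.chunkOf B Y.idx ∧
        ((∃ v, E.Decoded S p v Y.ident B t) ∨ E.FollowCommits S p Y.ident B t)) ∨
      (Y.idx = p ∧ ∃ q', ∃ t' ≤ t, E.recv p q' (.follow Y π) t'))

/-- An execution of the modified protocol under the mobile sluggish model. -/
structure Valid [NeZero n] : Prop where
  network : E.Network S
  honest : ∀ p ∈ E.honest, E.Follows S p

end Execution

end Hamster

/-!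
The safety proof for directly committed blocks rests on one moment in time. Let an honest node
directly commit `I` in view `v`. Every quorum of `f + s + 1` nodes contains a node that is honest and
prompt at any prescribed time (`Network.exists_prompt`). Let `T` be the earliest time at which an
honest committer of `I` has set its timer. A prompt member of the quorum from which it has proposals
with `C_v(I)` has sent such a proposal to everyone, so all nodes prompt at `σ = T + Δ` have it. None
of them has left view `v` by then, as otherwise its quit-view message would reach, by `T + 2Δ`, a
committer that is prompt at `T + 2Δ` and still in view `v`. This is
`Valid.exists_common_proposal`: all nodes prompt at `σ` are in view `v` and have `C_v(I)`.

Since `n ≥ 2(f + s) + 1`, these nodes form a quorum, and they lock on a certificate of at least the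
rank of `C_v(I)` when they leave the view. Every certificate that needs votes has a voter among them.
In view `v`
this voter excludes equivocation (`Valid.not_equivocates`), in later views its lock forces the block
to extend `I` (`Valid.extends_of_rank_le`, by induction on the rank).

The honest voters of a certificate have decoded its block or have voted for a new-view message with
a certificate of an earlier view for it; descending in the views gives a quorum of voters whose honest
members have decoded the block (`Valid.exists_decoded`). Their proposals carry certificates for the
predecessor, which propagates availability down the chain. Finally, collision freeness of the Merkle
tree and the MDS property make the block of an identifier block unique and force every decoding in
the Follow phase to return it.
-/

namespace Hamster

/-! ### Coding and hashing -/

section Coding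

variable {n k : ℕ} {F D P : Type*}

theorem encode_injective_of_isMDS [Field F] {G : Matrix (Fin n) (Fin k) F} (hG : IsMDS G)
    (hk : 1 ≤ k) {e : Fin k → Fin n} (he : Function.Injective e) {w w' : Word k F}
    (h : ∀ i, encode G w (e i) = encode G w' (e i)) : w = w' := by
  obtain ⟨ℓ, a⟩ := w
  obtain ⟨ℓ', a'⟩ := w'
  obtain rfl : ℓ = ℓ' := congrArg Sigma.fst (h ⟨0, hk⟩)
  have hdet : IsUnit (G.submatrix e id) :=
    (Matrix.isUnit_iff_isUnit_det _).2 (isUnit_iff_ne_zero.2 (hG ⟨e, he⟩))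
  suffices a = a' by rw [this]
  funext j c
  have key : (G.submatrix e id).mulVec (fun j => a j c) =
      (G.submatrix e id).mulVec (fun j => a' j c) := by
    funext i
    have := congrFun (eq_of_heq (Sigma.mk.inj (h i)).2) c
    simpa [Matrix.mulVec, dotProduct] using this
  exact congrFun (Matrix.mulVec_injective_of_isUnit hdet key) j

/-- A Merkle path that leads from a leaf to the root of a Merkle tree ends in a leaf of the tree:
since leaves and inner nodes are hashed differently, the path can be neither too short nor too
long. -/
theorem eq_of_climb_eq_merkle {hash : HashInput F D → D} (hhash : Function.Injective hash)
    {g : ℕ → Chunk F} {i : ℕ} {y : Chunk F} (d lo : ℕ) (p : List (Bool × D))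
    (h : climb hash (hash (.leaf i y)) p = merkle hash (fun j => hash (.leaf j (g j))) d lo) :
    y = g i := by
  induction d generalizing lo p with
  | zero =>
    match p with
    | [] =>
      have := hhash h
      injection this with h₁ h₂
      rw [h₂, h₁]
    | (true, _) :: _ => exact absurd (hhash h) (by simp)
    | (false, _) :: _ => exact absurd (hhash h) (by simp)
  | succ d ih =>
    match p with
    | [] => exact absurd (hhash h) (by simp)
    | (true, _) :: _ =>
      have := hhash h
      injection this with h₁ h₂
      exact ih _ _ h₁
    | (false, _) :: _ =>
      have := hhash h
      injection this with h₁ h₂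
      exact ih _ _ h₂

theorem eq_of_merkle_eq {hash : HashInput F D → D} (hhash : Function.Injective hash)
    {g g' : ℕ → Chunk F} (d lo : ℕ)
    (h : merkle hash (fun j => hash (.leaf j (g j))) d lo =
      merkle hash (fun j => hash (.leaf j (g' j))) d lo) :
    ∀ i, lo ≤ i → i < lo + 2 ^ d → g i = g' i := by
  induction d generalizing lo with
  | zero =>
    intro i h₁ h₂
    obtain rfl : lo = i := by simp at h₂; omega
    have := hhash h
    injection this
  | succ d ih =>
    intro i h₁ h₂
    have := hhash h
    injection this with hl hr
    rw [pow_succ] at h₂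
    by_cases hi : i < lo + 2 ^ d
    · exact ih _ hl i h₁ hi
    · exact ih _ hr i (by omega) (by omega)

namespace Protocol

variable [Field F] {S : Protocol n k F D P}

theorem eq_of_chunkOf_eq (hk : 1 ≤ k) (hG : IsMDS S.G) (hdivide : Function.Injective S.divide)
    {e : Fin k → Fin n} (he : Function.Injective e) {B B' : Block D P}
    (h : ∀ i, S.chunkOf B (e i) = S.chunkOf B' (e i)) : B = B' :=
  hdivide (encode_injective_of_isMDS hG hk he h)

theorem Identifies.unique (hk : 1 ≤ k) (hkn : k ≤ n) (hG : IsMDS S.G)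
    (hhash : Function.Injective S.hash) (hdivide : Function.Injective S.divide) {I : IdBlock D}
    {B B' : Block D P} (h : S.Identifies I B) (h' : S.Identifies I B') : B = B' := by
  obtain ⟨J, rfl⟩ := h
  obtain ⟨J', h'⟩ := h'
  injection h' with hroot _
  refine eq_of_chunkOf_eq hk hG hdivide (Fin.castLE_injective hkn) fun i => ?_
  have := eq_of_merkle_eq hhash _ _ hroot (Fin.castLE hkn i) (Nat.zero_le _)
    (by rw [zero_add]; exact (Fin.is_lt _).trans_le (Nat.le_pow_clog one_lt_two n))
  rwa [dif_pos (Fin.is_lt _), dif_pos (Fin.is_lt _)] at this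

/-- Segments verified against the identifier block of `B` carry coded chunks of `B`. -/
theorem Verifies.chunk_eq (hhash : Function.Injective S.hash) {Y : Segment n F D}
    {path : List (Bool × D)} {B : Block D P} (h : S.Verifies Y path)
    (hB : S.Identifies Y.ident B) : Y.chunk = S.chunkOf B Y.idx := by
  obtain ⟨J, h⟩ := h
  obtain ⟨J', hB⟩ := hB
  rw [h] at hB
  injection hB with hroot _
  simpa using eq_of_climb_eq_merkle hhash _ _ _ hroot

end Protocol

end Coding

/-! ### Chains of identifier blocks -/

namespace IdBlock

variable {D : Type*} {A B C : IdBlock D}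

theorem extends_genesis (A : IdBlock D) : A.Extends genesis := by
  induction A with
  | genesis => exact .refl _
  | next r A ih => exact .step r ih

theorem Extends.trans (h : A.Extends B) (h' : B.Extends C) : A.Extends C := by
  induction h with
  | refl => exact h'
  | step r _ ih => exact .step r (ih h')

theorem Extends.height_le (h : A.Extends B) : B.height ≤ A.height := by
  induction h with
  | refl => exact le_rfl
  | step r _ ih => exact ih.trans (Nat.le_succ _)

theorem Extends.eq_of_height_le (h : A.Extends B) (hle : A.height ≤ B.height) : A = B := by
  cases h with
  | refl => rfl
  | step r h =>
    have := h.height_le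
    simp only [height] at hle
    omega

/-- The predecessors of a block form a chain with one block of each height. -/
theorem Extends.unique (hB : A.Extends B) (hC : A.Extends C) (h : B.height = C.height) :
    B = C := by
  induction hB with
  | refl => exact hC.eq_of_height_le h.le
  | step r hB ih =>
    cases hC with
    | refl =>
      have := hB.height_le
      simp only [height] at h
      omega
    | step _ hC => exact ih hC h

theorem equivocates_of_height_eq (h : A.height = B.height) (hne : A ≠ B) : A.Equivocates B :=
  ⟨fun e => hne (e.eq_of_height_le h.le), fun e => hne (e.eq_of_height_le h.ge).symm⟩

theorem Equivocates.next (h : A.Equivocates B) (r : D) : A.Equivocates (.next r B) := by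
  refine ⟨fun e => h.1 (e.trans (.step r (.refl _))), fun e => ?_⟩
  cases e with
  | refl => exact h.1 (.step r (.refl _))
  | step _ e => exact h.2 e

end IdBlock

/-! ### Knowledge and evidence -/

namespace Execution

variable {n k : ℕ} {F D P : Type*} [Field F] {E : Execution n k F D} {S : Protocol n k F D P}

omit [Field F] in
theorem _root_.Hamster.Msg.mem_parts (m : Msg n k F D) : m ∈ m.parts := by
  cases m <;> simp [Msg.parts, LeaderMsg.parts]

theorem Knows.holds {p : Fin n} {m : Msg n k F D} {t : ℝ} (h : E.Knows S p m t) :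
    E.Holds S p m t := ⟨m, h, m.mem_parts⟩

theorem Knows.mono {p : Fin n} {m : Msg n k F D} {t t' : ℝ} (h : E.Knows S p m t) (ht : t ≤ t') :
    E.Knows S p m t' := by
  obtain ⟨q, hwf, u, hu, h⟩ := h
  exact ⟨q, hwf, u, hu.trans ht, h⟩

theorem Holds.mono {p : Fin n} {m : Msg n k F D} {t t' : ℝ} (h : E.Holds S p m t) (ht : t ≤ t') :
    E.Holds S p m t' := by
  obtain ⟨M, hM, hm⟩ := h
  exact ⟨M, hM.mono ht, hm⟩

theorem HoldsCert.mono {p : Fin n} {C : Cert n D} {t t' : ℝ} (h : E.HoldsCert S p C t)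
    (ht : t ≤ t') : E.HoldsCert S p C t' :=
  ⟨h.1, fun m hm => (h.2 m hm).mono ht⟩

theorem HasEvidence.mono {p : Fin n} {v : ℕ} {t t' : ℝ} (h : E.HasEvidence S p v t)
    (ht : t ≤ t') : E.HasEvidence S p v t' := by
  obtain ⟨ε, hε, h⟩ := h
  exact ⟨ε, hε, fun m hm => (h m hm).mono ht⟩

theorem Knows.holdsCert {p : Fin n} {m : LeaderMsg n F D} {t : ℝ}
    (h : E.Knows S p (.lead m) t) : E.HoldsCert S p m.cert t := by
  have hwf : S.CertWF m.cert := by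
    obtain ⟨_, hwf, _⟩ := h
    cases m with
    | proposal v Y C => exact hwf.2.1
    | newView v C => exact hwf.2
  exact ⟨hwf, fun x hx => ⟨_, h, Or.inr hx⟩⟩

theorem hasEvidence_of_equivocates {p : Fin n} {m₁ m₂ : LeaderMsg n F D} {v : ℕ} {t : ℝ}
    (h₁ : E.Knows S p (.lead m₁) t) (h₂ : E.Knows S p (.lead m₂) t) (hv₁ : m₁.view = v)
    (hv₂ : m₂.view = v) (h : m₁.block.Equivocates m₂.block) : E.HasEvidence S p v t := by
  refine ⟨.equivocation m₁ m₂, ⟨hv₁, hv₂, h₁.choose_spec.1, h₂.choose_spec.1, h⟩, ?_⟩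
  rintro m (hm | hm)
  · exact ⟨_, h₁, hm⟩
  · exact ⟨_, h₂, hm⟩

theorem Knows.hasEvidence_of_quit {p r : Fin n} {ε : Evidence n k F D} {v : ℕ} {t : ℝ}
    (h : E.Knows S p (.quit r ε v) t) : E.HasEvidence S p v t :=
  ⟨ε, h.choose_spec.1, fun _ hm => ⟨_, h, Or.inr hm⟩⟩

/-- The certificate has a quorum of voters, and the honest ones have voted by time `t`. -/
def VotedBy (E : Execution n k F D) (S : Protocol n k F D P) (C : Cert n D) (t : ℝ) : Prop :=
  S.quorum ≤ C.voters.card ∧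
    ∀ r ∈ C.voters, r ∈ E.honest → ∃ c, ∃ u ≤ t, E.sent r c (.vote r C.block C.view) u

omit [Field F] in
theorem VotedBy.formable {C : Cert n D} {t : ℝ} (h : E.VotedBy S C t) : E.Formable S C := by
  refine Or.inr ⟨h.1, fun r hr hh => ?_⟩
  obtain ⟨c, u, -, hu⟩ := h.2 r hr hh
  exact ⟨c, u, hu⟩

variable [NeZero n]

/-! ### Consequences of the network model -/

namespace Network

theorem sent_of_gotFrom (hN : E.Network S) {p q : Fin n} {m : Msg n k F D} {t : ℝ}
    (h : E.GotFrom S p q m t) : ∃ c, ∃ u ≤ t, E.sent q c m u := by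
  obtain ⟨-, u, hu, h | ⟨rfl, c, h⟩⟩ := h
  · obtain ⟨u', hu', h⟩ := hN.recv_sent _ _ _ _ h
    exact ⟨p, u', hu'.trans hu, h⟩
  · exact ⟨c, u, hu, h⟩

/-- Unforgeability: a message held by anyone was sent by its signer, if that one is honest. -/
theorem sent_of_holds (hN : E.Network S) {p r : Fin n} {m : Msg n k F D} {t : ℝ}
    (h : E.Holds S p m t) (hr : m.signer = some r) (hh : r ∈ E.honest) :
    ∃ c, ∃ u ≤ t, E.sent r c m u := by
  obtain ⟨M, ⟨q, hM⟩, hm⟩ := h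
  obtain ⟨c, u, hu, hs⟩ := hN.sent_of_gotFrom hM
  obtain ⟨c', u', hu', hs'⟩ := hN.unforgeable _ _ _ _ hs m hm r hr hh
  exact ⟨c', u', hu'.trans hu, hs'⟩

theorem isGenesis_or_votedBy (hN : E.Network S) {p : Fin n} {C : Cert n D} {t : ℝ}
    (h : E.HoldsCert S p C t) : C.IsGenesis ∨ E.VotedBy S C t :=
  h.1.imp_right fun hq =>
    ⟨hq, fun r hr hh => hN.sent_of_holds (h.2 _ ⟨r, hr, rfl⟩) rfl hh⟩

theorem formable_of_holdsCert (hN : E.Network S) {p : Fin n} {C : Cert n D} {t : ℝ}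
    (h : E.HoldsCert S p C t) : E.Formable S C :=
  (hN.isGenesis_or_votedBy h).elim Or.inl VotedBy.formable

omit [Field F] in
/-- Every quorum contains, at each time, a prompt node. -/
theorem exists_prompt (hN : E.Network S) {Q : Finset (Fin n)} (hQ : S.quorum ≤ Q.card) (τ : ℝ) :
    ∃ q ∈ Q, E.Prompt q τ := by
  by_contra! hcon
  have hsub : Q ⊆ E.honestᶜ ∪ E.sluggish τ := by
    intro q hq
    by_cases hh : q ∈ E.honest
    · have : q ∈ E.sluggish τ := by
        by_contra hs
        exact hcon q hq ⟨hh, hs⟩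
      exact Finset.mem_union_right _ this
    · exact Finset.mem_union_left _ (Finset.mem_compl.2 hh)
  have h₁ := (Finset.card_le_card hsub).trans (Finset.card_union_le _ _)
  have h₂ := hN.malicious_card
  have h₃ := hN.sluggish_card τ
  unfold Protocol.quorum at hQ
  omega

omit [Field F] in
open Classical in
theorem quorum_le_card_prompt (hN : E.Network S) (hn : 2 * (S.f + S.s) + 1 ≤ n) (τ : ℝ) :
    S.f + S.s + 1 ≤ (Finset.univ.filter (E.Prompt · τ)).card := by
  have hsub : (Finset.univ : Finset (Fin n)) ⊆
      Finset.univ.filter (E.Prompt · τ) ∪ (E.honestᶜ ∪ E.sluggish τ) := by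
    intro q _
    by_cases h : E.Prompt q τ
    · exact Finset.mem_union_left _ (Finset.mem_filter.2 ⟨Finset.mem_univ q, h⟩)
    · refine Finset.mem_union_right _ ?_
      rw [Finset.mem_union, Finset.mem_compl]
      by_contra! hcon
      exact h hcon
  have h₁ := (Finset.card_le_card hsub).trans (Finset.card_union_le _ _)
  have h₂ := Finset.card_union_le E.honestᶜ (E.sluggish τ)
  have h₃ := hN.malicious_card
  have h₄ := hN.sluggish_card τ
  rw [Finset.card_univ, Fintype.card_fin] at h₁
  omega

end Network

namespace Valid

theorem knows_of_sent (hE : E.Valid S) {p q : Fin n} {m : Msg n k F D} {t : ℝ}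
    (hp : p ∈ E.honest) (h : E.sent p q m t) : E.Knows S p m t :=
  ⟨p, (hE.honest p hp).legal _ _ _ h, t, le_rfl, Or.inr ⟨rfl, q, h⟩⟩

theorem knows_of_delivery (hE : E.Valid S) {p q : Fin n} {m : Msg n k F D} {t₀ t₁ t₂ : ℝ}
    (h : E.sent q p m t₀) (h₀ : t₀ ≤ t₁) (hq : E.Prompt q t₁) (hp : E.Prompt p t₂)
    (h₁ : t₁ + S.Δ ≤ t₂) : E.Knows S p m t₂ := by
  obtain ⟨u, hu, hr⟩ := hE.network.delivery _ _ _ _ _ _ h h₀ hq hp h₁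
  exact ⟨q, (hE.honest q hq.1).legal _ _ _ h, u, hu, Or.inl hr⟩

/-- What a prompt node knows against a leader when it leaves the view is known after `Δ` to all
prompt nodes. -/
theorem hasEvidence_of_prompt (hE : E.Valid S) {p q : Fin n} {v : ℕ} {t₁ t₂ : ℝ}
    (h : E.Entered S q (v + 1) t₁) (hq : E.Prompt q t₁) (hp : E.Prompt p t₂)
    (ht : t₁ + S.Δ ≤ t₂) : E.HasEvidence S p v t₂ := by
  obtain ⟨e, he, -, ⟨r, ε, hs⟩, -⟩ := (hE.honest q hq.1).leave v t₁ h
  exact (hE.knows_of_delivery (hs p) he hq hp ht).hasEvidence_of_quit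

/-- An honest node sends proposals for one block only of each height, since two of them are
evidence against the leader. Hence sending a proposal to someone entails sending one for the same
identifier block to all nodes. -/
theorem broadcast_of_sent_proposal (hE : E.Valid S) {p q : Fin n} {v : ℕ} {Y : Segment n F D}
    {C : Cert n D} {t : ℝ} (hp : p ∈ E.honest) (h : E.sent p q (.lead (.proposal v Y C)) t) :
    ∃ Y₀ C₀, C₀.block = C.block ∧
      ∃ u ≤ t, ∀ q', E.sent p q' (.lead (.proposal v Y₀ C₀)) u := by
  have hV := ((hE.honest p hp).propose _ _ _ _ _ h).1
  have hK := hE.knows_of_sent hp h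
  obtain ⟨Y₀, C₀, hht, hfirst, u, hu, hs⟩ :=
    (hE.honest p hp).repropose_first _ _ _ _ hV hK
  have hK₀ := hfirst _ _ _ rfl hK
  have hident : Y₀.ident = Y.ident := by
    by_contra hne
    exact hV.2 (hasEvidence_of_equivocates hK₀ hK rfl rfl
      (IdBlock.equivocates_of_height_eq hht hne))
  obtain ⟨_, ⟨-, -, r, hr⟩, -⟩ := hK
  obtain ⟨_, ⟨-, -, r₀, hr₀⟩, -⟩ := hK₀
  refine ⟨Y₀, C₀, ?_, u, hu, hs⟩
  rw [hr, hr₀] at hident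
  exact (IdBlock.next.inj hident).2

/-! ### Directly committed blocks -/

/-- The heart of the argument. Let `T` be the earliest time at which an honest committer sets its
timer. A node that is prompt at `T` and from which this committer has a proposal reaches all prompt
nodes at `σ = T + Δ`. None of these has left the view at `σ`, since its quit-view message would have
reached, by `T + 2Δ`, a committer that is prompt then and still waiting for its timer. -/
theorem exists_common_proposal (hE : E.Valid S) (hΔ : 0 < S.Δ) {r : Fin n}
    {I : IdBlock D} {v : ℕ} {t : ℝ} (h : E.DirectlyCommits S r I v t) :
    I ≠ .genesis ∧ ∃ σ Y C, C.block = I ∧ C.view = v ∧ E.VotedBy S C t ∧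
      ∀ z, E.Prompt z σ →
        E.InView S z v σ ∧ E.Knows S z (.lead (.proposal v Y C)) σ := by
  classical
  obtain ⟨Q, hQ, hQr⟩ := h
  have hcommit : ∀ x ∈ Q ∩ E.honest, ∃ T u, u ≤ t ∧ I ≠ .genesis ∧ E.InView S x v u ∧
      T + 2 * S.Δ ≤ u ∧ E.InView S x v T ∧ E.GotNewProposals S x I v T := by
    intro x hx
    obtain ⟨hxQ, hxh⟩ := Finset.mem_inter.1 hx
    obtain ⟨c, u, hu, hs⟩ := hE.network.sent_of_holds (hQr x hxQ).holds rfl hxh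
    obtain ⟨hI, hV, -, T, hT, hVT, hP⟩ := (hE.honest x hxh).precommit _ _ _ _ hs
    exact ⟨T, u, hu, hI, hV, hT, hVT, hP⟩
  choose! T u hut hI hVu hTu hVT hP using hcommit
  obtain ⟨x', hx'Q, hx'p⟩ := hE.network.exists_prompt hQ 0
  obtain ⟨x₀, hx₀, hmin⟩ := Finset.exists_min_image (Q ∩ E.honest) T
    ⟨x', Finset.mem_inter.2 ⟨hx'Q, hx'p.1⟩⟩
  obtain ⟨x₁, hx₁Q, hx₁p⟩ := hE.network.exists_prompt hQ (T x₀ + 2 * S.Δ)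
  have hx₁ : x₁ ∈ Q ∩ E.honest := Finset.mem_inter.2 ⟨hx₁Q, hx₁p.1⟩
  -- the timer of `x₁` was set no earlier than that of `x₀`, so it has not expired before `T x₀ + 2Δ`
  have hquiet : ¬ E.HasEvidence S x₁ v (T x₀ + 2 * S.Δ) := fun hev =>
    (hVu x₁ hx₁).2 (hev.mono (by linarith [hmin x₁ hx₁, hTu x₁ hx₁]))
  obtain ⟨R, hR, hRp⟩ := hP x₀ hx₀
  obtain ⟨y, hyR, hyp⟩ := hE.network.exists_prompt hR (T x₀)
  obtain ⟨Y', C', hC', hgot⟩ := hRp y hyR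
  obtain ⟨c, a, ha, hs⟩ := hE.network.sent_of_gotFrom hgot
  have hyV := ((hE.honest y hyp.1).propose _ _ _ _ _ hs).1
  obtain ⟨Y, C, hC, b, hb, hall⟩ := hE.broadcast_of_sent_proposal hyp.1 hs
  have hCI : C.block = I := hC.trans hC'
  have hyK := hE.knows_of_sent hyp.1 (hall y)
  have hCv : C.view = v := hyK.choose_spec.1.1
  refine ⟨hI x₀ hx₀, T x₀ + S.Δ, Y, C, hCI, hCv, ?_, fun z hz => ?_⟩
  · have hTt : a ≤ t := by linarith [hTu x₀ hx₀, hut x₀ hx₀]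
    exact (hE.network.isGenesis_or_votedBy (hyK.holdsCert.mono (hb.trans hTt))).resolve_left
      fun hgen => hI x₀ hx₀ (hCI ▸ hgen.2)
  · have hyT : ∀ w, w ≤ v → E.Entered S y w (T x₀) := fun w hw w' hw' =>
      (hyV.1 w' (hw'.trans_le hw)).mono ha
    have hzv : E.Entered S z v (T x₀ + S.Δ) := fun w hw =>
      hE.hasEvidence_of_prompt (hyT (w + 1) hw) hyp hz le_rfl
    refine ⟨⟨hzv, fun hev => hquiet ?_⟩,
      hE.knows_of_delivery (hall z) (hb.trans ha) hyp hz le_rfl⟩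
    refine hE.hasEvidence_of_prompt (t₁ := T x₀ + S.Δ) (fun w hw => ?_) hz hx₁p (by linarith)
    rcases Nat.lt_succ_iff_lt_or_eq.1 hw with hw | rfl
    · exact hzv w hw
    · exact hev

theorem exists_leaderMsg_of_vote (hE : E.Valid S) (hk : 1 ≤ k) {p q : Fin n} {J : IdBlock D}
    {v : ℕ} {t : ℝ} (hp : p ∈ E.honest) (h : E.sent p q (.vote p J v) t) :
    ∃ m : LeaderMsg n F D, m.view = v ∧ m.block = J ∧ E.Knows S p (.lead m) t := by
  obtain ⟨-, -, ⟨B, -, Y, C, -, hY⟩ | ⟨C, hC, hK, -⟩⟩ := (hE.honest p hp).vote _ _ _ _ h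
  · obtain ⟨hJ, -, hK⟩ := hY ⟨0, hk⟩
    exact ⟨.proposal _ _ _, rfl, hJ, hK⟩
  · exact ⟨.newView _ _, rfl, hC, hK⟩

/-- Among the voters of an equivocating certificate one is prompt at the time at which all prompt
nodes have the proposal that carries the certificate for `I`. This node would have evidence against
the leader while in the view. -/
theorem not_equivocates (hE : E.Valid S) (hk : 1 ≤ k) (hΔ : 0 < S.Δ) {r : Fin n} {I : IdBlock D}
    {v : ℕ} {t : ℝ} (h : E.DirectlyCommits S r I v t) {C : Cert n D} (hv : C.view = v)
    (hC : E.Formable S C) : ¬ C.block.Equivocates I := by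
  intro heq
  obtain ⟨-, σ, Y, C₀, hC₀, -, -, hσ⟩ := hE.exists_common_proposal hΔ h
  rcases hC with hgen | ⟨hq, hvotes⟩
  · exact heq.2 (hgen.2 ▸ I.extends_genesis)
  · obtain ⟨p, hpC, hp⟩ := hE.network.exists_prompt hq σ
    obtain ⟨c, u, hs⟩ := hvotes p hpC hp.1
    rw [hv] at hs
    obtain ⟨m, hmv, hmC, hm⟩ := hE.exists_leaderMsg_of_vote hk hp.1 hs
    obtain ⟨hpV, hpK⟩ := hσ p hp
    obtain ⟨_, ⟨-, -, r', hr'⟩, -⟩ := id hpK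
    have hne : m.block.Equivocates (LeaderMsg.proposal v Y C₀).block := by
      rw [hmC, LeaderMsg.block, hr', hC₀]
      exact heq.next r'
    rcases le_total u σ with hu | hu
    · exact hpV.2 (hasEvidence_of_equivocates (hm.mono hu) hpK hmv rfl hne)
    · exact ((hE.honest p hp.1).vote _ _ _ _ hs).1.2
        (hasEvidence_of_equivocates hm (hpK.mono hu) hmv rfl hne)

/-- A certificate held before leaving view `v` bounds the rank of all locks after view `v`. -/
theorem holdsCert_lock (hE : E.Valid S) {p : Fin n} (hp : p ∈ E.honest) {C : Cert n D} {w v : ℕ}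
    {σ e : ℝ} (hV : ¬ E.HasEvidence S p v σ) (hC : E.HoldsCert S p C σ) (hvw : v ≤ w)
    (he : E.Entered S p (w + 1) e) :
    E.HoldsCert S p (E.lock p (w + 1)) e ∧ C.rank ≤ (E.lock p (w + 1)).rank := by
  obtain ⟨e', he', hent, -, hhigh, -⟩ := (hE.honest p hp).leave w e he
  refine ⟨hhigh.1.mono he', hhigh.2 C (hC.mono ?_)⟩
  by_contra! hlt
  exact hV ((hent.1 v (Nat.lt_succ_of_le hvw)).mono hlt.le)

/-- By induction on the rank of `C`: a voter of `C` that is prompt when all prompt nodes have the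
certificate for `I` is locked on a certificate of at least its rank in all later views. If it voted
for a new-view message, that one carries a certificate of an earlier view and of sufficient rank; if
it voted for a proposal, that one carries a certificate of the same view for the predecessor. -/
theorem extends_of_rank_le (hE : E.Valid S) (hk : 1 ≤ k) (hΔ : 0 < S.Δ) {r : Fin n}
    {I : IdBlock D} {v : ℕ} {t : ℝ} (h : E.DirectlyCommits S r I v t) (C : Cert n D)
    (hC : E.Formable S C) (hrank : toLex (v, I.height) ≤ C.rank) : C.block.Extends I := by
  induction hw : C.rank using WellFoundedLT.induction generalizing C with
  | ind w ih =>
  subst hw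
  rcases (Prod.Lex.toLex_le_toLex.1 hrank) with hlt | ⟨hv, hht⟩
  · dsimp only at hlt
    obtain ⟨-, σ, Y, C₀, hC₀, hC₀v, -, hσ⟩ := hE.exists_common_proposal hΔ h
    rcases hC with hgen | ⟨hq, hvotes⟩
    · exact absurd hlt (by rw [hgen.1]; exact Nat.not_lt_zero v)
    obtain ⟨p, hpC, hp⟩ := hE.network.exists_prompt hq σ
    obtain ⟨c, u, hs⟩ := hvotes p hpC hp.1
    obtain ⟨hpV, hpK⟩ := hσ p hp
    obtain ⟨hV, -, ⟨B, -, Y', C', -, hY'⟩ | ⟨C', hC', hK, hlock, -⟩⟩ :=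
      (hE.honest p hp.1).vote _ _ _ _ hs
    · obtain ⟨hident, -, hK⟩ := hY' ⟨0, hk⟩
      have hform := hE.network.formable_of_holdsCert hK.holdsCert
      obtain ⟨_, ⟨hview, -, r', hr'⟩, -⟩ := id hK
      rw [hr'] at hident
      rw [← hident]
      refine .step r' (ih _ ?_ _ hform ?_ rfl)
      · refine Prod.Lex.toLex_lt_toLex.2 (Or.inr ⟨hview, ?_⟩)
        dsimp only [LeaderMsg.cert]
        rw [← hident]
        exact Nat.lt_succ_self _
      · exact Prod.Lex.toLex_le_toLex.2 (Or.inl (hlt.trans_eq hview.symm))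
    · have hform := hE.network.formable_of_holdsCert hK.holdsCert
      obtain ⟨_, ⟨hview, -⟩, -⟩ := id hK
      rw [← hC']
      refine ih _ (Prod.Lex.toLex_lt_toLex.2 (Or.inl hview)) _ hform ?_ rfl
      obtain ⟨w, hw⟩ : ∃ w, C.view = w + 1 := Nat.exists_eq_succ_of_ne_zero (by omega)
      have hle := (hE.holdsCert_lock hp.1 hpV.2 hpK.holdsCert (w := w) (by omega)
        (hw ▸ hV.1)).2
      rw [← hw] at hle
      have hrk : toLex (v, I.height) = (LeaderMsg.proposal v Y C₀).cert.rank := by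
        simp only [LeaderMsg.cert, Cert.rank, hC₀, hC₀v]
      exact hrk ▸ hle.trans hlock
  · by_contra hne
    refine hE.not_equivocates hk hΔ h hv.symm hC ⟨hne, fun e => hne ?_⟩
    rw [e.eq_of_height_le hht]
    exact .refl _

theorem extends_or_extends (hE : E.Valid S) (hk : 1 ≤ k) (hΔ : 0 < S.Δ) {r r' : Fin n}
    {I I' : IdBlock D} {v v' : ℕ} {t t' : ℝ} (h : E.DirectlyCommits S r I v t)
    (h' : E.DirectlyCommits S r' I' v' t') (hv : v ≤ v') : I.Extends I' ∨ I'.Extends I := by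
  obtain ⟨-, -, -, C, hC, hCv, hvotes, -⟩ := hE.exists_common_proposal hΔ h'
  rcases hv.lt_or_eq with hlt | rfl
  · rw [← hC]
    exact Or.inr (hE.extends_of_rank_le hk hΔ h C hvotes.formable
      (Prod.Lex.toLex_le_toLex.2 (Or.inl (hlt.trans_eq hCv.symm))))
  · have := hE.not_equivocates hk hΔ h hCv hvotes.formable
    rw [hC, IdBlock.Equivocates] at this
    tauto

theorem commits_unique (hE : E.Valid S) (hk : 1 ≤ k) (hΔ : 0 < S.Δ) {p q : Fin n}
    {I J : IdBlock D} {t u : ℝ} (hI : E.Commits S p I t) (hJ : E.Commits S q J u)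
    (h : I.height = J.height) : I = J := by
  obtain ⟨I', v, hI', hII⟩ := hI
  obtain ⟨J', w, hJ', hJJ⟩ := hJ
  have hcomp : I'.Extends J' ∨ J'.Extends I' := (le_total v w).elim
    (fun hvw => hE.extends_or_extends hk hΔ hI' hJ' hvw)
    fun hwv => (hE.extends_or_extends hk hΔ hJ' hI' hwv).symm
  rcases hcomp with hc | hc
  · exact hII.unique (hc.trans hJJ) h
  · exact (hc.trans hII).unique hJJ h

/-! ### Availability of committed blocks -/

/-- Following new-view messages back to earlier views, one reaches a view in which all honest voters
have decoded the block. -/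
theorem exists_decoded (hE : E.Valid S) (hk : 1 ≤ k) (hkn : k ≤ n) (hG : IsMDS S.G)
    (hhash : Function.Injective S.hash) (hdivide : Function.Injective S.divide) {C : Cert n D}
    {t : ℝ} (hC : E.VotedBy S C t) (hne : C.block ≠ .genesis) :
    ∃ B, S.Identifies C.block B ∧ ∃ w ≤ C.view,
      (∀ τ, ∃ q, E.Prompt q τ ∧ ∃ u ≤ t, E.Decoded S q w C.block B u ∧ E.InView S q w u) ∧
      (w = C.view ∨ ∃ C', C'.block = C.block ∧
        ∃ x ∈ E.honest, E.Knows S x (.lead (.newView C.view C')) t) := by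
  induction hv : C.view using Nat.strong_induction_on generalizing C with
  | h v ih =>
  subst hv
  by_cases hall : ∀ p ∈ C.voters, p ∈ E.honest →
      ∃ B, ∃ u ≤ t, E.Decoded S p C.view C.block B u ∧ E.InView S p C.view u
  · obtain ⟨p, hpC, hp⟩ := hE.network.exists_prompt hC.1 0
    obtain ⟨B, _, _, hB, -⟩ := hall p hpC hp.1
    refine ⟨B, hB.1, _, le_rfl, fun τ => ?_, Or.inl rfl⟩
    obtain ⟨q, hqC, hq⟩ := hE.network.exists_prompt hC.1 τ
    obtain ⟨B', u, hu, hB', hV⟩ := hall q hqC hq.1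
    obtain rfl := hB.1.unique hk hkn hG hhash hdivide hB'.1
    exact ⟨q, hq, u, hu, hB', hV⟩
  · push Not at hall
    obtain ⟨p, hpC, hp, hnot⟩ := hall
    obtain ⟨c, u, hu, hs⟩ := hC.2 p hpC hp
    obtain ⟨hV, -, ⟨B, hB⟩ | ⟨C', hC', hK, -, -⟩⟩ := (hE.honest p hp).vote _ _ _ _ hs
    · exact absurd hV (hnot B u hu hB)
    · have hvotes := (hE.network.isGenesis_or_votedBy (hK.holdsCert.mono hu)).resolve_left
        fun hgen => hne (hC' ▸ hgen.2)
      obtain ⟨B, hB, w, hw, hdec, -⟩ :=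
        ih C'.view hK.choose_spec.1.1 hvotes (by rwa [← hC'] at hne) rfl
      dsimp only [LeaderMsg.cert] at hB hdec
      rw [hC'] at hB hdec
      exact ⟨B, hB, w, hw.trans hK.choose_spec.1.1.le, hdec,
        Or.inr ⟨C', hC', p, hp, hK.mono hu⟩⟩

/-- A node that decoded a block has a proposal with a certificate for the predecessor, so that all
predecessors of a certified block are certified. -/
theorem exists_votedBy_of_extends (hE : E.Valid S) (hk : 1 ≤ k) (hkn : k ≤ n) (hG : IsMDS S.G)
    (hhash : Function.Injective S.hash) (hdivide : Function.Injective S.divide) {J I : IdBlock D}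
    {t : ℝ} (hext : J.Extends I) (hI : I ≠ .genesis) {C : Cert n D} (hC : E.VotedBy S C t)
    (hJ : C.block = J) : ∃ C', C'.block = I ∧ E.VotedBy S C' t := by
  induction hext generalizing C with
  | refl => exact ⟨C, hJ, hC⟩
  | step r hext ih =>
    obtain ⟨B, -, w, -, hdec, -⟩ :=
      hE.exists_decoded hk hkn hG hhash hdivide hC (by rw [hJ]; exact nofun)
    obtain ⟨q, -, u, hu, ⟨-, Y, C', -, hY⟩, -⟩ := hdec 0
    obtain ⟨hident, -, hK⟩ := hY ⟨0, hk⟩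
    obtain ⟨_, ⟨-, -, r', hr'⟩, -⟩ := id hK
    rw [hr', hJ] at hident
    have hA := (IdBlock.next.inj hident).2
    refine ih hI ((hE.network.isGenesis_or_votedBy (hK.holdsCert.mono hu)).resolve_left
      fun hgen => hI ?_) hA
    have hgen := hgen.2
    dsimp only [LeaderMsg.cert] at hgen
    rw [hA] at hgen
    rw [hgen] at hext
    cases hext
    rfl

theorem exists_decoded_of_commits (hE : E.Valid S) (hk : 1 ≤ k) (hkn : k ≤ n) (hΔ : 0 < S.Δ)
    (hG : IsMDS S.G) (hhash : Function.Injective S.hash) (hdivide : Function.Injective S.divide)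
    {p : Fin n} {I : IdBlock D} {t : ℝ} (h : E.Commits S p I t) (hI : I ≠ .genesis) :
    ∃ B, S.Identifies I B ∧ ∀ τ, ∃ q, E.Prompt q τ ∧ ∃ u ≤ t, ∃ w, E.Decoded S q w I B u := by
  obtain ⟨J, v, hJ, hext⟩ := h
  obtain ⟨-, -, -, C, hC, -, hvotes, -⟩ := hE.exists_common_proposal hΔ hJ
  obtain ⟨C', rfl, hvotes'⟩ :=
    hE.exists_votedBy_of_extends hk hkn hG hhash hdivide hext hI hvotes hC
  obtain ⟨B, hB, w, -, hdec, -⟩ := hE.exists_decoded hk hkn hG hhash hdivide hvotes' hI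
  refine ⟨B, hB, fun τ => ?_⟩
  obtain ⟨q, hq, u, hu, hqB, -⟩ := hdec τ
  exact ⟨q, hq, u, hu, w, hqB⟩

/-- The segments decoded in the Follow phase are verified against `I`, hence they are chunks of the
block of `I` that was decoded before `I` was committed. -/
theorem identifies_of_followCommits (hE : E.Valid S) (hk : 1 ≤ k) (hkn : k ≤ n) (hΔ : 0 < S.Δ)
    (hG : IsMDS S.G) (hhash : Function.Injective S.hash) (hdivide : Function.Injective S.divide)
    {p : Fin n} {I : IdBlock D} {B : Block D P} {t : ℝ} (h : E.FollowCommits S p I B t) :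
    S.Identifies I B := by
  obtain ⟨hI, Y, path, hinj, hY⟩ := h
  have hne : I ≠ .genesis := by
    obtain ⟨hident, -, ⟨J, hver⟩, -⟩ := hY ⟨0, hk⟩
    rw [← hident, hver]
    exact nofun
  obtain ⟨B₀, hB₀, -⟩ := hE.exists_decoded_of_commits hk hkn hΔ hG hhash hdivide hI hne
  suffices B = B₀ from this ▸ hB₀
  refine Protocol.eq_of_chunkOf_eq hk hG hdivide hinj fun i => ?_
  obtain ⟨hident, hchunk, hver, -⟩ := hY i
  rw [← hchunk]
  exact hver.chunk_eq hhash (hident ▸ hB₀)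

end Valid
end Execution
end Hamster

theorem mainTheorem4 {n k : ℕ} [NeZero n] {F D P : Type*} [Field F]
    (S : Hamster.Protocol n k F D P)
    (hn : 2 * (S.f + S.s) + 1 ≤ n) (hk : 1 ≤ k) (hkn : k ≤ n) (hΔ : 0 < S.Δ)
    (hG : Hamster.IsMDS S.G) (hhash : Function.Injective S.hash)
    (hdivide : Function.Injective S.divide)
    (E : Hamster.Execution n k F D) (hE : E.Valid S) :
    (∀ r ∈ E.honest, ∀ I v t, E.DirectlyCommits S r I v t →
      -- (i) at every time, some prompt node decoded the block of `I`
      (∃ B, S.Identifies I B ∧ ∀ τ, ∃ q, E.Prompt q τ ∧ ∃ u ≤ t, ∃ w ≤ v,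
        E.Decoded S q w I B u ∧ E.InView S q w u ∧
        (w = v ∨ ∃ C, C.block = I ∧ ∃ x ∈ E.honest, E.Knows S x (.lead (.newView v C)) t)) ∧
      -- (ii) no equivocating certificate in view `v`
      (∀ C, C.view = v → E.Formable S C → ¬ C.block.Equivocates I) ∧
      -- (iii) enough honest nodes lock on a certificate of at least the rank of `I`
      (∃ Q ⊆ E.honest, S.f + S.s + 1 ≤ Q.card ∧ ∀ q ∈ Q,
        (∃ C u, E.InView S q v u ∧ E.HoldsCert S q C u ∧ toLex (v, I.height) ≤ C.rank) ∧
        ∀ e, E.EntersAt S q (v + 1) e → E.HoldsCert S q (E.lock q (v + 1)) e ∧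
          toLex (v, I.height) ≤ (E.lock q (v + 1)).rank)) ∧
    -- certificates of at least the rank of a directly committed block extend it
    (∀ r ∈ E.honest, ∀ I v t, E.DirectlyCommits S r I v t →
      ∀ C, E.Formable S C → toLex (v, I.height) ≤ C.rank → C.block.Extends I) ∧
    -- weak safety
    (∀ p ∈ E.honest, ∀ q ∈ E.honest, ∀ I J t u, E.Commits S p I t → E.Commits S q J u →
      I.height = J.height → I = J) ∧
    (∀ p ∈ E.honest, ∀ I t, E.Commits S p I t → I ≠ .genesis →
      ∃ B, S.Identifies I B ∧ ∀ τ, ∃ q, E.Prompt q τ ∧ ∃ u ≤ t, ∃ w, E.Decoded S q w I B u) ∧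
    -- safety
    (∀ p ∈ E.honest, ∀ q ∈ E.honest, ∀ I J B B' t u, E.FollowCommits S p I B t →
      E.FollowCommits S q J B' u → I.height = J.height → B = B') := by
  classical
  refine ⟨fun r hr I v t h => ⟨?_, fun C hv hC => hE.not_equivocates hk hΔ h hv hC, ?_⟩,
    fun r hr I v t h C hC hrank => hE.extends_of_rank_le hk hΔ h C hC hrank,
    fun p hp q hq I J t u hI hJ hht => hE.commits_unique hk hΔ hI hJ hht,
    fun p hp I t hI hne => hE.exists_decoded_of_commits hk hkn hΔ hG hhash hdivide hI hne,
    fun p hp q hq I J B B' t u hB hB' hht => ?_⟩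
  · obtain ⟨hI, -, -, C, rfl, rfl, hvotes, -⟩ := hE.exists_common_proposal hΔ h
    obtain ⟨B, hB, w, hw, hdec, hcase⟩ := hE.exists_decoded hk hkn hG hhash hdivide hvotes hI
    refine ⟨B, hB, fun τ => ?_⟩
    obtain ⟨q, hq, u, hu, hqB, hqV⟩ := hdec τ
    exact ⟨q, hq, u, hu, w, hw, hqB, hqV, hcase⟩
  · obtain ⟨-, σ, Y, C, rfl, rfl, -, hσ⟩ := hE.exists_common_proposal hΔ h
    refine ⟨Finset.univ.filter (E.Prompt · σ), fun q hq => (Finset.mem_filter.1 hq).2.1,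
      hE.network.quorum_le_card_prompt hn σ, fun q hq => ?_⟩
    have hq := (Finset.mem_filter.1 hq).2
    obtain ⟨hV, hK⟩ := hσ q hq
    exact ⟨⟨C, σ, hV, hK.holdsCert, le_rfl⟩, fun e he =>
      hE.holdsCert_lock hq.1 hV.2 hK.holdsCert le_rfl he.1⟩
  · obtain rfl := hE.commits_unique hk hΔ hB.1 hB'.1 hht
    exact (hE.identifies_of_followCommits hk hkn hΔ hG hhash hdivide hB).unique hk hkn hG hhash
      hdivide (hE.identifies_of_followCommits hk hkn hΔ hG hhash hdivide hB')
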